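/- Let $\ell\ge 0$ and $1\le k_1<k_2$ be integers. Consider the linear structural equation model $\mathcal M_{2,\ell}$ with two observed variables, in which $1$ is a source: $$X_1=\sum_{j=1}^{\ell}L_j+\epsilon_1,\qquad X_2=\lambda_{21}X_1+\sum_{j=1}^{\ell}\gamma_{2j}L_j+\epsilon_2,$$ where $\lambda_{21}\in\mathbb R$ (possibly $0$), $\gamma_{2j}\in\mathbb R\setminus\{0\}$, and the exogenous sources $\eta=(\epsilon_1,\epsilon_2,L_1,\dots,L_\ell)$ are mutually independent, non-Gaussian, centered, with finite moments up to order $k_2$. The scale of the latent variables is fixed by $\gamma_{1j}=1$. For $v,w\in\{1,2\}$, $v\ne w$, let $C^{(k)}$ be the $k$-th order cumulant tensor of $(X_v,X_w)$, where $$\mathrm{cum}(Z_1,\dots,Z_k)=\sum_{\pi}(-1)^{|\pi|-1}(|\pi|-1)!\prod_{I\in\pi}E\Big[\prod_{j\in I}Z_j\Big],$$ with $\pi$ ranging over the set partitions of $\{1,\dots,k\}$. For $k\ge k_1$ let $\mathrm{fl}_{k_1}(C^{(k)})$ be the symmetric flattening, with rows indexed by $i_{k_1+1}\le\dots\le i_k$,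 columns indexed by $i_1\le\dots\le i_{k_1}$ (indices referring to the components of $(X_v,X_w)$), and entries $c^{(k)}_{i_1\dots i_k}$. Let $A^{(k_1,\dots,k_2)}_{v\to w}$ be obtained by stacking $\mathrm{fl}_{k_1}(C^{(k_1)}),\dots,\mathrm{fl}_{k_1}(C^{(k_2)})$ vertically and removing the last column, the one with $(i_1,\dots,i_{k_1})=(2,\dots,2)$. Let $m$ be the minimum of its number of rows and its number of columns. "Generically" means: there is a nonzero polynomial, depending only on $\ell,k_1,k_2$, in the free parameters such that the assertion holds for every distribution in the model at whose parameters the polynomial does not vanish. The free parameters are the coefficients $\gamma_{2j}$ and the cumulants of orders $2,\dots,k_2$ of all components of $\eta$, together with $\lambda_{21}$ in the case $\lambda_{21}\ne0$. Then: a) $A^{(k_1,\dots,k_2)}_{1\to2}$ has rank at most $\ell+1$ and, both in the case $\lambda_{21}\ne 0$ and in the case $\lambda_{21}=0$, generically rank exactly $\min(\ell+1,m)$. b) If $\lambda_{21}\neq0$, then $A^{(k_1,\dots,k_2)}_{2\to1}$ has rank at most $\ell+2$ and generically rank exactly $\min(\ell+2,m)$. c) If $\lambda_{21}=0$, then $A^{(k_1,\dots,k_2)}_{2\to1}$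 has rank at most $\ell+1$ and generically rank exactly $\min(\ell+1,m)$. -/

import Mathlib

open MeasureTheory ProbabilityTheory

universe u

/-- The `k`-th order cumulant tensor of the random vector `Z = (Z_a)_{a : ι}` under `P`:
`cum(Z_{i 1}, …, Z_{i k}) = ∑_π (-1)^(|π|-1) (|π|-1)! ∏_{B ∈ π} E[∏_{j ∈ B} Z_{i j}]`,
the sum being over all set partitions `π` of the `k` positions. -/
noncomputable def cumulantTensor {Ω ι : Type*} [MeasurableSpace Ω] (P : Measure Ω)
    (Z : ι → Ω → ℝ) (k : ℕ) (i : Fin k → ι) : ℝ :=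
  ∑ π : Finpartition (Finset.univ : Finset (Fin k)),
    (-1 : ℝ) ^ (π.parts.card - 1) * (Nat.factorial (π.parts.card - 1) : ℝ) *
      ∏ B ∈ π.parts, ∫ ω, ∏ j ∈ B, Z (i j) ω ∂P

/-- Weakly increasing multi-indices `i₁ ≤ ⋯ ≤ i_h` with entries in an `n`-element set. -/
abbrev SortedIndex (n h : ℕ) : Type := {i : Fin h → Fin n // Monotone i}

noncomputable instance SortedIndex.instFintype (n h : ℕ) : Fintype (SortedIndex n h) :=
  Fintype.ofFinite _

/-- The `h`-th symmetric flattening of a symmetric tensor `T` of order `k = h + d`: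
columns are indexed by `i₁ ≤ ⋯ ≤ i_h`, rows by `i_{h+1} ≤ ⋯ ≤ i_k`. -/
def symFlattening {n h d : ℕ} (T : (Fin (h + d) → Fin n) → ℝ) :
    Matrix (SortedIndex n d) (SortedIndex n h) ℝ :=
  Matrix.of fun row col => T (Fin.append col.1 row.1)

/-- Row indices of the stacked matrix: an order `k = k₁ + d` with `k₁ ≤ k ≤ k₂`, and a row of the
`k₁`-th flattening of an order `k` tensor. -/
abbrev StackedRow (k₁ k₂ : ℕ) : Type := Σ d : Fin (k₂ - k₁ + 1), SortedIndex 2 d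

/-- Column indices of the stacked matrix: all columns of the flattenings except the last one,
which has the multi-index `(2, …, 2)` (written `1 : Fin 2` here). -/
abbrev StackedCol (k₁ : ℕ) : Type := {col : SortedIndex 2 k₁ // col.1 ≠ fun _ => 1}

noncomputable instance StackedCol.instFintype (k₁ : ℕ) : Fintype (StackedCol k₁) :=
  Fintype.ofFinite _

/-- The matrix `A_{v → w}^{(k₁, …, k₂)}` for real random variables `V = X_v` and `W = X_w`: the
`k₁`-th symmetric flattenings of the cumulant tensors of orders `k₁, …, k₂` of `(V, W)`, stacked
vertically, with the last column removed. -/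
noncomputable def stackedCumulantMatrix {Ω : Type*} [MeasurableSpace Ω] (P : Measure Ω)
    (V W : Ω → ℝ) (k₁ k₂ : ℕ) : Matrix (StackedRow k₁ k₂) (StackedCol k₁) ℝ :=
  Matrix.of fun row col =>
    symFlattening (cumulantTensor P ![V, W] (k₁ + (row.1 : ℕ))) row.2 col.1

/-- The minimum of the number of rows and the number of columns of the stacked matrix. -/
noncomputable def stackedMinDim (k₁ k₂ : ℕ) : ℕ :=
  min (Nat.card (StackedRow k₁ k₂)) (Nat.card (StackedCol k₁))

/-- A linear structural equation model with two observed variables `X₁ = X 0` and `X₂ = X 1`,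
`ℓ` latent confounders, edges `L_j → X₁`, `L_j → X₂` and `X₁ → X₂` (so `1` is a source among the
observed variables; `lam = λ₂₁` may be zero). The scale of the latent variables is fixed
by `γ_{1j} = 1`, and `gamma j = γ_{2j}`. Moments are finite up to order `K`. -/
structure TwoVariableModel (ℓ K : ℕ) : Type (u + 1) where
  Ω : Type u
  [measurableSpace : MeasurableSpace Ω]
  P : Measure Ω
  [isProbabilityMeasure : IsProbabilityMeasure P]
  lam : ℝ
  gamma : Fin ℓ → ℝ
  eps : Fin 2 → Ω → ℝ
  L : Fin ℓ → Ω → ℝ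
  X : Fin 2 → Ω → ℝ
  gamma_ne_zero : ∀ j, gamma j ≠ 0
  indep : iIndepFun (Sum.elim eps L) P
  memLp : ∀ s, MemLp (Sum.elim eps L s) K P
  centered : ∀ s, ∫ ω, Sum.elim eps L s ω ∂P = 0
  nonGaussian : ∀ s, ¬ HasGaussianLaw (Sum.elim eps L s) P
  eq_one : ∀ᵐ ω ∂P, X 0 ω = ∑ j, L j ω + eps 0 ω
  eq_two : ∀ᵐ ω ∂P, X 1 ω = lam * X 0 ω + ∑ j, gamma j * L j ω + eps 1 ω

attribute [instance] TwoVariableModel.measurableSpace TwoVariableModel.isProbabilityMeasure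

namespace TwoVariableModel

/-- The vector `η = (ε, L)` of all exogenous sources. -/
def eta {ℓ K : ℕ} (S : TwoVariableModel.{u} ℓ K) : Fin 2 ⊕ Fin ℓ → S.Ω → ℝ :=
  Sum.elim S.eps S.L

/-- The matrix `A_{1 → 2}^{(k₁, …, k₂)}`. -/
noncomputable def A₁₂ {ℓ K : ℕ} (S : TwoVariableModel.{u} ℓ K) (k₁ k₂ : ℕ) :
    Matrix (StackedRow k₁ k₂) (StackedCol k₁) ℝ :=
  stackedCumulantMatrix S.P (S.X 0) (S.X 1) k₁ k₂

/-- The matrix `A_{2 → 1}^{(k₁, …, k₂)}`. -/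
noncomputable def A₂₁ {ℓ K : ℕ} (S : TwoVariableModel.{u} ℓ K) (k₁ k₂ : ℕ) :
    Matrix (StackedRow k₁ k₂) (StackedCol k₁) ℝ :=
  stackedCumulantMatrix S.P (S.X 1) (S.X 0) k₁ k₂

end TwoVariableModel

/-- Names of the model parameters other than `λ₂₁`: the coefficients `γ_{2j}`, and the cumulants of
the exogenous sources of the orders `2, …, K` (the sources are centered, so those of order one
vanish). -/
inductive FreeParam (ℓ K : ℕ) : Type where
  | gamma (j : Fin ℓ) : FreeParam ℓ K
  | cumulant (s : Fin 2 ⊕ Fin ℓ) (k : Finset.Icc 2 K) : FreeParam ℓ K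

namespace TwoVariableModel

/-- The parameter point `(γ, ω)` of a model; used when `λ₂₁ = 0`. -/
noncomputable def freeParams {ℓ K : ℕ} (S : TwoVariableModel.{u} ℓ K) : FreeParam ℓ K → ℝ
  | .gamma j => S.gamma j
  | .cumulant s k => cumulantTensor S.P S.eta (k : ℕ) fun _ => s

/-- The parameter point `(λ₂₁, γ, ω)` of a model; the index `none` stands for `λ₂₁`. -/
noncomputable def allParams {ℓ K : ℕ} (S : TwoVariableModel.{u} ℓ K) :
    Option (FreeParam ℓ K) → ℝ
  | none => S.lam
  | some p => S.freeParams p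

end TwoVariableModel

/-- The property `Q` of models in `M` with parameter vectors `param S ∈ ℝ^σ` holds generically: there
is a proper algebraic subset of the parameter space outside of which `Q` holds. -/
def HoldsGenerically {σ M : Type*} (param : M → σ → ℝ) (Q : M → Prop) : Prop :=
  ∃ f : MvPolynomial σ ℝ, f ≠ 0 ∧ ∀ S : M, MvPolynomial.eval (param S) f ≠ 0 → Q S

/-! Both observed variables are linear combinations of independent sources. By multilinearity and
the vanishing of mixed cumulants, each entry of the stacked matrix is a sum over the sources `s` of
`κ_k(s)` times a product of coefficients, so the matrix factors through the sources. Since the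
column `(W, …, W)` is removed, every remaining column contains `V`, and a source absent from `V`
contributes nothing. Counting the sources that enter `V` gives the rank bounds
(`sourceMatrix_rank_le`).

For the generic lower bound, the determinant of a compression `B * A * D` to size `p` is a
polynomial in the parameters, so one parameter point where it is nonzero suffices; this point need
not come from a distribution. Choose coefficients with distinct ratios `W/V`, pick `p` different
rows, and give the `i`-th source a nonzero cumulant only at the order of the `i`-th row. The matrix
then splits into two Vandermonde-type factors of rank `p` (`exists_mul_sourceMatrix_mul_eq_one`).

Mixed cumulants vanish because a cumulant is the linear coefficient of `partitionPoly`, which under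
independence is a product of two polynomials without constant term. -/

/-! ### Set partitions and the partition polynomial -/

section Combinatorics

open Finset Polynomial

/-- A map `g : α → β` is the same thing as a partition of `α` together with an injective
labelling of its parts by elements of `β`. -/
theorem Finpartition.bijective_embedding_comp_part (α β : Type*) [Fintype α] [DecidableEq α] :
    Function.Bijective
      (fun (x : Σ π : Finpartition (univ : Finset α), (π.parts ↪ β)) (a : α) =>
        x.2 ⟨x.1.part a, x.1.part_mem.2 (mem_univ a)⟩) := by
  classical
  constructor
  · rintro ⟨π, e⟩ ⟨π', e'⟩ h
    have key : ∀ a b, π.part a = π.part b ↔ π'.part a = π'.part b := by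
      intro a b
      have ha := congrFun h a
      have hb := congrFun h b
      simp only at ha hb
      constructor
      · intro hab
        have : e ⟨π.part a, π.part_mem.2 (mem_univ a)⟩ = e ⟨π.part b, π.part_mem.2 (mem_univ b)⟩ := by
          congr 2
        rw [ha, hb] at this
        simpa using e'.injective this
      · intro hab
        have : e' ⟨π'.part a, π'.part_mem.2 (mem_univ a)⟩ =
            e' ⟨π'.part b, π'.part_mem.2 (mem_univ b)⟩ := by
          congr 2
        rw [← ha, ← hb] at this
        simpa using e.injective this
    have hpart : ∀ a, π.part a = π'.part a := by
      intro a
      ext b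
      rw [π.mem_part_iff_part_eq_part (mem_univ _) (mem_univ _),
        π'.mem_part_iff_part_eq_part (mem_univ _) (mem_univ _)]
      exact key _ _
    have hparts : ∀ ρ ρ' : Finpartition (univ : Finset α), (∀ a, ρ.part a = ρ'.part a) →
        ρ.parts ⊆ ρ'.parts := by
      intro ρ ρ' hρ B hB
      obtain ⟨a, ha⟩ := ρ.nonempty_of_mem_parts hB
      rw [← ρ.part_eq_of_mem hB ha, hρ]
      exact ρ'.part_mem.2 (mem_univ a)
    have hπ : π = π' := Finpartition.ext
      ((hparts _ _ hpart).antisymm (hparts _ _ fun a => (hpart a).symm))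
    subst hπ
    congr 1
    ext ⟨B, hB⟩
    obtain ⟨a, ha⟩ := π.nonempty_of_mem_parts hB
    have := congrFun h a
    simp only [π.part_eq_of_mem hB ha] at this
    exact this
  · intro g
    let π := Finpartition.ofSetoid (Setoid.ker g)
    have hπ : ∀ a b, b ∈ π.part a ↔ g a = g b := fun a b =>
      Finpartition.mem_part_ofSetoid_iff_rel (s := Setoid.ker g)
    have hB : ∀ B : π.parts, ∃ a, a ∈ B.1 := fun B => π.nonempty_of_mem_parts B.2
    choose r hr using hB
    refine ⟨⟨π, ⟨fun B => g (r B), ?_⟩⟩, ?_⟩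
    · intro B B' h
      have h1 := π.part_eq_of_mem B.2 (hr B)
      have h2 : r B' ∈ B.1 := by
        rw [← h1, hπ]
        exact h
      exact Subtype.ext (π.eq_of_mem_parts B.2 B'.2 h2 (hr B'))
    · funext a
      exact ((hπ a _).1 (hr ⟨π.part a, π.part_mem.2 (mem_univ a)⟩)).symm

/-- Group the colourings `g` by their partition into fibres: the falling factorial counts the
injective labellings of the parts, and unused colours contribute `m ∅ = 1`. -/
theorem sum_prod_fiber_eq_sum_finpartition {α : Type*} [Fintype α] [DecidableEq α] (N : ℕ)
    (m : Finset α → ℝ) (hm : m ∅ = 1) :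
    ∑ g : α → Fin N, ∏ c, m ({a | g a = c} : Finset α) =
      ∑ π : Finpartition (univ : Finset α),
        (N.descFactorial π.parts.card : ℝ) * ∏ B ∈ π.parts, m B := by
  classical
  rw [← (Finpartition.bijective_embedding_comp_part α (Fin N)).sum_comp, Fintype.sum_sigma]
  refine Finset.sum_congr rfl fun π _ => ?_
  have : ∀ e : π.parts ↪ Fin N, ∏ c, m ({a | e ⟨π.part a, π.part_mem.2 (mem_univ a)⟩ = c} :
      Finset α) = ∏ B ∈ π.parts, m B := by
    intro e
    rw [← Finset.prod_coe_sort π.parts]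
    have h1 : ∀ B : π.parts, m B.1 = m ({a | e ⟨π.part a, π.part_mem.2 (mem_univ a)⟩ = e B} :
        Finset α) := by
      intro B
      congr 1
      ext a
      simp only [mem_filter, mem_univ, true_and, EmbeddingLike.apply_eq_iff_eq]
      rw [Subtype.ext_iff]
      exact (π.part_eq_iff_mem B.2).symm
    rw [Finset.prod_congr rfl fun B _ => h1 B]
    symm
    refine Finset.prod_of_injOn e e.injective.injOn (by simp) ?_ (fun _ _ => rfl)
    intro c _ hc
    rw [← hm]
    congr 1
    rw [Finset.filter_eq_empty_iff]
    intro a _ h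
    exact hc ⟨_, by simp, h⟩
  rw [Finset.sum_congr rfl fun e _ => this e, Finset.sum_const, Finset.card_univ,
    Fintype.card_embedding_eq]
  simp

/-- The polynomial `∑_π (x)_{|π|} ∏_{B ∈ π} m(B)` in the indeterminate `x`. -/
noncomputable def partitionPoly {α : Type*} [Fintype α] [DecidableEq α] (m : Finset α → ℝ) :
    ℝ[X] :=
  ∑ π : Finpartition (univ : Finset α),
    descPochhammer ℝ π.parts.card * C (∏ B ∈ π.parts, m B)

theorem partitionPoly_eval_natCast {α : Type*} [Fintype α] [DecidableEq α] (m : Finset α → ℝ)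
    (hm : m ∅ = 1) (N : ℕ) :
    (partitionPoly m).eval (N : ℝ) = ∑ g : α → Fin N, ∏ c, m ({a | g a = c} : Finset α) := by
  rw [sum_prod_fiber_eq_sum_finpartition N m hm, partitionPoly, eval_finsetSum]
  refine Finset.sum_congr rfl fun π _ => ?_
  rw [eval_mul, eval_C, descPochhammer_eval_eq_descFactorial]

theorem Finpartition.parts_card_pos_of_univ {α : Type*} [Fintype α] [DecidableEq α] [Nonempty α]
    (π : Finpartition (univ : Finset α)) : 0 < π.parts.card :=
  Finset.card_pos.2 (π.parts_nonempty univ_nonempty.ne_empty)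

theorem partitionPoly_coeff_zero {α : Type*} [Fintype α] [DecidableEq α] [Nonempty α]
    (m : Finset α → ℝ) : (partitionPoly m).coeff 0 = 0 := by
  rw [coeff_zero_eq_eval_zero, partitionPoly, eval_finsetSum]
  refine Finset.sum_eq_zero fun π _ => ?_
  rw [eval_mul, descPochhammer_ne_zero_eval_zero ℝ π.parts_card_pos_of_univ.ne', zero_mul]

theorem descPochhammer_eval_neg_one (n : ℕ) :
    (descPochhammer ℝ n).eval (-1) = (-1) ^ n * (n.factorial : ℝ) := by
  induction n with
  | zero => simp
  | succ n ih =>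
    rw [descPochhammer_succ_eval, ih, Nat.factorial_succ]
    push_cast
    ring

/-- Since `(x)_n = x (x - 1)_{n-1}`, the linear coefficient is the value of `(y)_{n-1}` at `y = -1`.
-/
theorem descPochhammer_coeff_one {n : ℕ} (hn : 0 < n) :
    (descPochhammer ℝ n).coeff 1 = (-1) ^ (n - 1) * ((n - 1).factorial : ℝ) := by
  obtain ⟨n, rfl⟩ : ∃ k, n = k + 1 := ⟨n - 1, by omega⟩
  rw [descPochhammer_succ_left, coeff_X_mul, coeff_zero_eq_eval_zero, eval_comp]
  simp [descPochhammer_eval_neg_one]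

theorem partitionPoly_coeff_one {α : Type*} [Fintype α] [DecidableEq α] [Nonempty α]
    (m : Finset α → ℝ) : (partitionPoly m).coeff 1 =
      ∑ π : Finpartition (univ : Finset α), (-1 : ℝ) ^ (π.parts.card - 1) *
        (Nat.factorial (π.parts.card - 1) : ℝ) * ∏ B ∈ π.parts, m B := by
  rw [partitionPoly, finsetSum_coeff]
  refine Finset.sum_congr rfl fun π _ => ?_
  rw [coeff_mul_C, descPochhammer_coeff_one π.parts_card_pos_of_univ]

/-- If a multiplicative set function splits along `p` and its complement, then so does its
partition polynomial. -/
theorem partitionPoly_eq_mul {α : Type*} [Fintype α] [DecidableEq α] (p : α → Prop)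
    [DecidablePred p] (m : Finset α → ℝ) (hm : m ∅ = 1)
    (hsplit : ∀ B, m B = m (B.filter p) * m (B.filter fun a => ¬ p a)) :
    partitionPoly m =
      partitionPoly (fun B : Finset {a // p a} => m (B.map (Function.Embedding.subtype _))) *
      partitionPoly (fun B : Finset {a // ¬ p a} => m (B.map (Function.Embedding.subtype _))) := by
  -- At a natural number `N` both sides count colourings, and a colouring of `α` is a pair of
  -- colourings of the two halves.
  refine Polynomial.eq_of_infinite_eval_eq _ _ (Set.infinite_of_injective_forall_mem
    (Nat.cast_injective (R := ℝ)) fun N => ?_)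
  simp only [Set.mem_ofPred_eq, eval_mul]
  rw [partitionPoly_eval_natCast _ hm, partitionPoly_eval_natCast _ (by simpa using hm),
    partitionPoly_eval_natCast _ (by simpa using hm),
    ← (Equiv.piEquivPiSubtypeProd p fun _ => Fin N).symm.sum_comp, Fintype.sum_prod_type,
    Finset.sum_mul_sum]
  refine Finset.sum_congr rfl fun g _ => Finset.sum_congr rfl fun h _ => ?_
  rw [← Finset.prod_mul_distrib]
  refine Finset.prod_congr rfl fun c _ => ?_
  rw [hsplit]
  congr 2
  · ext a
    by_cases ha : p a <;> simp [Equiv.piEquivPiSubtypeProd, ha]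
  · ext a
    by_cases ha : p a <;> simp [Equiv.piEquivPiSubtypeProd, ha]

/-- The sum is the linear coefficient of a product of two polynomials with zero constant term. -/
theorem sum_finpartition_eq_zero_of_split {α : Type*} [Fintype α] [DecidableEq α] (p : α → Prop)
    [DecidablePred p] (hp : ∃ a, p a) (hp' : ∃ a, ¬ p a) (m : Finset α → ℝ) (hm : m ∅ = 1)
    (hsplit : ∀ B, m B = m (B.filter p) * m (B.filter fun a => ¬ p a)) :
    ∑ π : Finpartition (univ : Finset α), (-1 : ℝ) ^ (π.parts.card - 1) *
        (Nat.factorial (π.parts.card - 1) : ℝ) * ∏ B ∈ π.parts, m B = 0 := by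
  have : Nonempty α := ⟨hp.choose⟩
  have : Nonempty {a // p a} := ⟨⟨_, hp.choose_spec⟩⟩
  have : Nonempty {a // ¬ p a} := ⟨⟨_, hp'.choose_spec⟩⟩
  rw [← partitionPoly_coeff_one, partitionPoly_eq_mul p m hm hsplit, mul_coeff_one,
    partitionPoly_coeff_zero, partitionPoly_coeff_zero]
  ring

end Combinatorics

/-! ### Multilinearity of cumulants and independence -/

section Cumulants

open Finset

variable {Ω : Type*} [MeasurableSpace Ω] {P : Measure Ω}

theorem integrable_prod_of_memLp [IsFiniteMeasure P] {ι : Type*} {K : ℕ} {s : Finset ι}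
    (hs : s.card ≤ K) {Z : ι → Ω → ℝ} (hZ : ∀ j ∈ s, MemLp (Z j) K P) :
    Integrable (fun ω => ∏ j ∈ s, Z j ω) P := by
  have h := MemLp.prod' (p := fun _ => (K : ENNReal)) hZ
  refine h.integrable ?_
  rw [ENNReal.one_le_inv, Finset.sum_const, nsmul_eq_mul, ← div_eq_mul_inv]
  refine ENNReal.div_le_of_le_mul ?_
  rw [one_mul]
  exact_mod_cast hs

/-- The space of functions with a finite `K`-th moment. -/
def memLpSubmodule (P : Measure Ω) (K : ℕ) : Submodule ℝ (Ω → ℝ) where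
  carrier := {f | MemLp f K P}
  add_mem' := fun hf hg => hf.add hg
  zero_mem' := MemLp.zero
  smul_mem' := fun c _ hf => hf.const_smul c

/-- Only the part containing `j₀` sees the updated variable, so linearity of one integral gives
linearity in each slot. -/
theorem Finpartition.prod_integral_update {k : ℕ} (π : Finpartition (univ : Finset (Fin k)))
    (Z : Fin k → Ω → ℝ) (j₀ : Fin k) (x : Ω → ℝ) :
    ∏ B ∈ π.parts, ∫ ω, ∏ j ∈ B, Function.update Z j₀ x j ω ∂P =
      (∫ ω, x ω * ∏ j ∈ (π.part j₀).erase j₀, Z j ω ∂P) *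
        ∏ B ∈ π.parts.erase (π.part j₀), ∫ ω, ∏ j ∈ B, Z j ω ∂P := by
  rw [← Finset.mul_prod_erase _ _ (π.part_mem.2 (mem_univ j₀))]
  congr 1
  · refine integral_congr_ae (Filter.Eventually.of_forall fun ω => ?_)
    simp only
    rw [← Finset.mul_prod_erase _ _ (π.mem_part_self.2 (mem_univ j₀)), Function.update_self]
    congr 1
    refine Finset.prod_congr rfl fun j hj => ?_
    rw [Function.update_of_ne (Finset.ne_of_mem_erase hj)]
  · refine Finset.prod_congr rfl fun B hB => ?_
    refine integral_congr_ae (Filter.Eventually.of_forall fun ω => ?_)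
    refine Finset.prod_congr rfl fun j hj => ?_
    rw [Function.update_of_ne]
    rintro rfl
    exact Finset.ne_of_mem_erase hB (π.part_eq_of_mem (Finset.mem_of_mem_erase hB) hj).symm

theorem Finpartition.prod_integral_update_coe {K k : ℕ}
    (π : Finpartition (univ : Finset (Fin k))) (Z : Fin k → memLpSubmodule P K) (j₀ : Fin k)
    (x : memLpSubmodule P K) :
    ∏ B ∈ π.parts, ∫ ω, ∏ j ∈ B, (Function.update Z j₀ x j : Ω → ℝ) ω ∂P =
      (∫ ω, (x : Ω → ℝ) ω * ∏ j ∈ (π.part j₀).erase j₀, (Z j : Ω → ℝ) ω ∂P) *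
        ∏ B ∈ π.parts.erase (π.part j₀), ∫ ω, ∏ j ∈ B, (Z j : Ω → ℝ) ω ∂P := by
  rw [← π.prod_integral_update (P := P) (fun j => (Z j : Ω → ℝ)) j₀ x]
  have : Function.update (fun j => (Z j : Ω → ℝ)) j₀ x =
      fun j => (Function.update Z j₀ x j : Ω → ℝ) := by
    funext j
    by_cases h : j = j₀
    · subst h; simp
    · simp [h]
  rw [this]

/-- The product over a partition of the joint moments of its parts, as a multilinear map. -/
noncomputable def partitionMoment (P : Measure Ω) [IsFiniteMeasure P] {K k : ℕ} (hk : k ≤ K)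
    (π : Finpartition (univ : Finset (Fin k))) :
    MultilinearMap ℝ (fun _ : Fin k => memLpSubmodule P K) ℝ where
  toFun Z := ∏ B ∈ π.parts, ∫ ω, ∏ j ∈ B, (Z j : Ω → ℝ) ω ∂P
  map_update_add' := by
    intro inst Z j₀ x y
    obtain rfl : inst = instDecidableEqFin k := Subsingleton.elim _ _
    have hint : ∀ x : memLpSubmodule P K, Integrable
        (fun ω => (x : Ω → ℝ) ω * ∏ j ∈ (π.part j₀).erase j₀, (Z j : Ω → ℝ) ω) P := by
      intro x
      have h := integrable_prod_of_memLp (P := P) (K := K) (s := π.part j₀)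
        (Z := fun j => (Function.update Z j₀ x j : Ω → ℝ))
        (((Finset.card_le_univ _).trans (by simp)).trans hk) (fun j _ => (Function.update Z j₀ x j).2)
      refine h.congr (Filter.Eventually.of_forall fun ω => ?_)
      simp only
      rw [← Finset.mul_prod_erase _ _ (π.mem_part_self.2 (mem_univ j₀)), Function.update_self]
      congr 1
      refine Finset.prod_congr rfl fun j hj => ?_
      rw [Function.update_of_ne (Finset.ne_of_mem_erase hj)]
    have key := π.prod_integral_update_coe (P := P) Z j₀
    refine (key (x + y)).trans ?_
    refine Eq.trans ?_ (congrArg₂ (· + ·) (key x) (key y)).symm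
    rw [← add_mul, ← integral_add (hint x) (hint y)]
    simp [add_mul]
  map_update_smul' := by
    intro inst Z j₀ c x
    obtain rfl : inst = instDecidableEqFin k := Subsingleton.elim _ _
    have key := π.prod_integral_update_coe (P := P) Z j₀
    refine (key (c • x)).trans ?_
    refine Eq.trans ?_ (congrArg (c • ·) (key x)).symm
    simp [mul_assoc, integral_const_mul]

/-- The joint cumulant of `k` random variables with finite `K`-th moments, as a multilinear map. -/
noncomputable def cumulantMap (P : Measure Ω) [IsFiniteMeasure P] {K k : ℕ} (hk : k ≤ K) :
    MultilinearMap ℝ (fun _ : Fin k => memLpSubmodule P K) ℝ :=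
  ∑ π : Finpartition (univ : Finset (Fin k)),
    ((-1 : ℝ) ^ (π.parts.card - 1) * (Nat.factorial (π.parts.card - 1) : ℝ)) •
      partitionMoment P hk π

theorem cumulantMap_apply [IsFiniteMeasure P] {K k : ℕ} (hk : k ≤ K) {ι : Type*}
    (Z : ι → memLpSubmodule P K) (i : Fin k → ι) :
    cumulantMap P hk (fun j => Z (i j)) = cumulantTensor P (fun a => (Z a : Ω → ℝ)) k i := by
  simp [cumulantMap, cumulantTensor, partitionMoment]

/-- Cumulants of linear combinations. -/
theorem cumulantTensor_linear_combination [IsFiniteMeasure P] {K k : ℕ} (hk : k ≤ K)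
    {ι S : Type*} [Fintype S] {η : S → Ω → ℝ} (hη : ∀ s, MemLp (η s) K P)
    (c : ι → S → ℝ) (i : Fin k → ι) :
    cumulantTensor P (fun a ω => ∑ s, c a s * η s ω) k i =
      ∑ f : Fin k → S, (∏ j, c (i j) (f j)) * cumulantTensor P η k f := by
  classical
  let η' : S → memLpSubmodule P K := fun s => ⟨η s, hη s⟩
  have h1 := cumulantMap_apply (P := P) hk (fun a => ∑ s, c a s • η' s) i
  have h2 : (fun a => ((∑ s, c a s • η' s : memLpSubmodule P K) : Ω → ℝ)) =
      fun a ω => ∑ s, c a s * η s ω := by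
    funext a ω
    simp [η', Finset.sum_apply]
  rw [h2] at h1
  rw [← h1, MultilinearMap.map_sum]
  refine Finset.sum_congr rfl fun f _ => ?_
  rw [MultilinearMap.map_smul_univ, smul_eq_mul, cumulantMap_apply hk η' f]

theorem cumulantTensor_congr_ae {ι : Type*} {Z W : ι → Ω → ℝ} (h : ∀ a, Z a =ᵐ[P] W a) (k : ℕ)
    (i : Fin k → ι) : cumulantTensor P Z k i = cumulantTensor P W k i := by
  refine Finset.sum_congr rfl fun π _ => ?_
  congr 1
  refine Finset.prod_congr rfl fun B _ => integral_congr_ae ?_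
  have := (Filter.eventually_all_finset B).2 fun j _ => h (i j)
  filter_upwards [this] with ω hω
  exact Finset.prod_congr rfl fun j hj => hω j hj

/-- Mixed cumulants of independent random variables vanish. -/
theorem cumulantTensor_eq_zero_of_iIndepFun [IsProbabilityMeasure P] {k : ℕ}
    {S : Type*} [Fintype S] {η : S → Ω → ℝ} (hm : ∀ s, AEMeasurable (η s) P)
    (hind : iIndepFun η P) (f : Fin k → S) {a b : Fin k} (hab : f a ≠ f b) :
    cumulantTensor P η k f = 0 := by
  classical
  refine sum_finpartition_eq_zero_of_split (fun j => f j = f a) ⟨a, rfl⟩ ⟨b, hab.symm⟩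
    (fun B => ∫ ω, ∏ j ∈ B, η (f j) ω ∂P) (by simp) fun B => ?_
  have h := hind.indepFun_finset₀ {f a} ({f a}ᶜ) disjoint_compl_right hm
  let B₁ := B.filter fun j => f j = f a
  let B₂ := B.filter fun j => ¬ f j = f a
  -- The two partial products are functions of the disjoint source families `{f a}` and its
  -- complement, hence independent.
  let φ₁ : (({f a} : Finset S) → ℝ) → ℝ := fun x =>
    ∏ j ∈ B₁.attach, x ⟨f j, by have := (Finset.mem_filter.1 j.2).2; simpa using this⟩
  let φ₂ : ((({f a} : Finset S)ᶜ : Finset S) → ℝ) → ℝ := fun x =>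
    ∏ j ∈ B₂.attach, x ⟨f j, by have := (Finset.mem_filter.1 j.2).2; simpa using this⟩
  have hφ₁ : Measurable φ₁ := Finset.measurable_fun_prod _ fun j _ => measurable_pi_apply _
  have hφ₂ : Measurable φ₂ := Finset.measurable_fun_prod _ fun j _ => measurable_pi_apply _
  have h' := h.comp hφ₁ hφ₂
  have e₁ : (φ₁ ∘ fun ω (s : ({f a} : Finset S)) => η s ω) = fun ω => ∏ j ∈ B₁, η (f j) ω := by
    funext ω
    exact Finset.prod_attach B₁ fun j => η (f j) ω
  have e₂ : (φ₂ ∘ fun ω (s : (({f a} : Finset S)ᶜ : Finset S)) => η s ω) =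
      fun ω => ∏ j ∈ B₂, η (f j) ω := by
    funext ω
    exact Finset.prod_attach B₂ fun j => η (f j) ω
  rw [e₁, e₂] at h'
  have hmeas : ∀ B : Finset (Fin k), AEStronglyMeasurable (fun ω => ∏ j ∈ B, η (f j) ω) P :=
    fun B => (Finset.aemeasurable_fun_prod B fun j _ => hm (f j)).aestronglyMeasurable
  rw [← h'.integral_fun_mul_eq_mul_integral (hmeas _) (hmeas _)]
  refine integral_congr_ae (Filter.Eventually.of_forall fun ω => ?_)
  exact (Finset.prod_filter_mul_prod_filter_not B (fun j => f j = f a) _).symm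

/-- In the multilinear expansion only constant source assignments survive; `0 < k` makes those of
different sources distinct. -/
theorem cumulantTensor_independent_sum [IsProbabilityMeasure P] {K k : ℕ} (hk0 : 0 < k)
    (hk : k ≤ K) {ι S : Type*} [Fintype S] {η : S → Ω → ℝ} (hη : ∀ s, MemLp (η s) K P)
    (hind : iIndepFun η P) (c : ι → S → ℝ) (i : Fin k → ι) :
    cumulantTensor P (fun a ω => ∑ s, c a s * η s ω) k i =
      ∑ s, cumulantTensor P η k (fun _ => s) * ∏ j, c (i j) s := by
  classical
  rw [cumulantTensor_linear_combination hk hη]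
  have hinj : Function.Injective (fun (s : S) (_ : Fin k) => s) :=
    fun s t h => congrFun h ⟨0, hk0⟩
  symm
  refine Finset.sum_of_injOn (fun s _ => s) hinj.injOn (by simp) ?_
    (fun s _ => mul_comm _ _)
  intro f _ hf
  suffices ∃ a b, f a ≠ f b by
    obtain ⟨a, b, hab⟩ := this
    rw [cumulantTensor_eq_zero_of_iIndepFun (fun s => (hη s).1.aemeasurable) hind f hab, mul_zero]
  by_contra! hcon
  exact hf ⟨f ⟨0, hk0⟩, by simp, funext fun j => hcon _ _⟩

theorem cumulantTensor_one_eq_zero {ι : Type*} {Z : ι → Ω → ℝ} (i : Fin 1 → ι)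
    (h : ∫ ω, Z (i 0) ω ∂P = 0) : cumulantTensor P Z 1 i = 0 := by
  refine Finset.sum_eq_zero fun π _ => ?_
  obtain ⟨B, hB⟩ := Finset.card_pos.1 π.parts_card_pos_of_univ
  rw [Finset.prod_eq_zero hB, mul_zero]
  have : B = {0} := (Finset.subset_singleton_iff.1 fun x _ => by
    simpa using Subsingleton.elim x 0).resolve_left (π.ne_empty hB)
  simpa [this] using h

end Cumulants

/-! ### Sorted binary indices and their weights -/

section SortedIndices

open Finset

/-- The number of entries equal to the second index. -/
def SortedIndex.weight {h : ℕ} (i : SortedIndex 2 h) : ℕ := ∑ j, (i.1 j : ℕ)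

theorem SortedIndex.weight_eq_card {h : ℕ} (i : SortedIndex 2 h) :
    i.weight = (univ.filter fun j => i.1 j = 1).card := by
  rw [SortedIndex.weight, Finset.card_filter]
  refine Finset.sum_congr rfl fun j _ => ?_
  generalize i.1 j = x
  fin_cases x <;> rfl

/-- A sorted binary index is a block of zeros followed by a block of ones, so its weight determines
it. -/
theorem SortedIndex.apply_eq_one_iff {h : ℕ} (i : SortedIndex 2 h) (j : Fin h) :
    i.1 j = 1 ↔ h ≤ (j : ℕ) + i.weight := by
  rw [i.weight_eq_card]
  constructor
  · intro hj
    have : Finset.Ici j ⊆ univ.filter fun j => i.1 j = 1 := by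
      intro l hl
      simp only [mem_filter, mem_univ, true_and]
      have := i.2 (Finset.mem_Ici.1 hl)
      omega
    have := Finset.card_le_card this
    rw [Fin.card_Ici] at this
    omega
  · intro hj
    by_contra hcon
    have : (univ.filter fun j => i.1 j = 1) ⊆ Finset.Ioi j := by
      intro l hl
      simp only [mem_filter, mem_univ, true_and] at hl
      rw [Finset.mem_Ioi]
      by_contra hlj
      have := i.2 (not_lt.1 hlj)
      omega
    have := Finset.card_le_card this
    rw [Fin.card_Ioi] at this
    have := j.2
    omega

theorem SortedIndex.weight_injective (h : ℕ) :
    Function.Injective (SortedIndex.weight : SortedIndex 2 h → ℕ) := by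
  intro i i' hw
  refine Subtype.ext (funext fun j => ?_)
  have h1 := i.apply_eq_one_iff j
  have h2 := i'.apply_eq_one_iff j
  rw [hw, ← h2] at h1
  omega

theorem SortedIndex.weight_le {h : ℕ} (i : SortedIndex 2 h) : i.weight ≤ h := by
  rw [i.weight_eq_card]
  exact (Finset.card_le_univ _).trans (by simp)

theorem SortedIndex.exists_weight_eq {h r : ℕ} (hr : r ≤ h) :
    ∃ i : SortedIndex 2 h, i.weight = r := by
  refine ⟨⟨fun j => if (j : ℕ) + r < h then 0 else 1, ?_⟩, ?_⟩
  · intro a b hab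
    have : (a : ℕ) ≤ b := hab
    dsimp only
    split_ifs <;> omega
  · rw [SortedIndex.weight_eq_card]
    have : (univ.filter fun j : Fin h => (if (j : ℕ) + r < h then (0 : Fin 2) else 1) = 1) =
        (univ.filter fun j : Fin h => (j : ℕ) < h - r)ᶜ := by
      ext j
      simp only [mem_filter, mem_univ, true_and, mem_compl]
      split_ifs <;> simp <;> omega
    simp only [this]
    rw [Finset.card_compl, Fintype.card_fin, Fin.card_filter_val_lt]
    omega

theorem StackedRow.ext_weight {k₁ k₂ : ℕ} {row row' : StackedRow k₁ k₂} (h : row.1 = row'.1)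
    (hw : row.2.weight = row'.2.weight) : row = row' := by
  obtain ⟨d, i⟩ := row
  obtain ⟨d', i'⟩ := row'
  obtain rfl : d = d' := h
  exact congrArg (Sigma.mk d) (SortedIndex.weight_injective _ hw)

theorem SortedIndex.weight_lt_iff {h : ℕ} (i : SortedIndex 2 h) :
    i.weight < h ↔ i.1 ≠ fun _ => 1 := by
  constructor
  · intro hi hcon
    rw [i.weight_eq_card, hcon] at hi
    simp at hi
  · intro hi
    by_contra hcon
    exact hi (funext fun j => (i.apply_eq_one_iff j).2 (by omega))

theorem StackedCol.card_le (k₁ : ℕ) : Fintype.card (StackedCol k₁) ≤ k₁ := by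
  have := Fintype.card_le_of_injective
    (fun i : StackedCol k₁ => (⟨i.1.weight, i.1.weight_lt_iff.2 i.2⟩ : Fin k₁))
    fun i i' hi => Subtype.ext (SortedIndex.weight_injective k₁ (by simpa using hi))
  simpa using this

/-- This turns the coefficient products into scaled Vandermonde entries in the ratio `t`. -/
theorem SortedIndex.prod_apply {h : ℕ} (i : SortedIndex 2 h) {c : Fin 2 → ℝ} {t : ℝ}
    (hc : c 1 = c 0 * t) : ∏ j, c (i.1 j) = c 0 ^ h * t ^ i.weight := by
  have : ∀ x : Fin 2, c x = c 0 * t ^ (x : ℕ) := by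
    intro x
    fin_cases x <;> simp [hc]
  rw [Finset.prod_congr rfl fun j _ => this (i.1 j), Finset.prod_mul_distrib,
    Finset.prod_pow_eq_pow_sum]
  simp [SortedIndex.weight]

end SortedIndices

/-! ### Rank of the source matrix -/

section Rank

open Finset Polynomial

/-- Vandermonde independence: test the relation against the polynomial vanishing at every node but
one. -/
theorem eq_zero_of_sum_mul_pow_eq_zero {ι : Type*} [DecidableEq ι] {t x : ι → ℝ}
    (ht : Function.Injective t) {G : Finset ι} {n : ℕ} (hG : G.card ≤ n)
    (h : ∀ r < n, ∑ i ∈ G, x i * t i ^ r = 0) : ∀ i ∈ G, x i = 0 := by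
  intro i hi
  have hpoly : ∀ q : ℝ[X], q.natDegree < n → ∑ j ∈ G, x j * q.eval (t j) = 0 := by
    intro q hq
    simp_rw [eval_eq_sum_range' hq, Finset.mul_sum]
    rw [Finset.sum_comm]
    refine Finset.sum_eq_zero fun r hr => ?_
    rw [← mul_zero (q.coeff r), ← h r (Finset.mem_range.1 hr), Finset.mul_sum]
    exact Finset.sum_congr rfl fun j _ => by ring
  have hcard := Finset.card_erase_of_mem hi
  have hpos := Finset.card_pos.2 ⟨i, hi⟩
  have h1 := hpoly (∏ j ∈ G.erase i, (X - C (t j))) (by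
    rw [natDegree_prod_of_monic _ _ fun j _ => monic_X_sub_C _]
    simp
    omega)
  rw [Finset.sum_eq_single_of_mem i hi] at h1
  · refine (mul_eq_zero.1 h1).resolve_right ?_
    rw [eval_prod]
    refine Finset.prod_ne_zero_iff.2 fun j hj => ?_
    simp only [eval_sub, eval_X, eval_C]
    exact sub_ne_zero.2 fun hij => Finset.ne_of_mem_erase hj (ht hij).symm
  · intro j hj hji
    rw [eval_prod, Finset.prod_eq_zero (Finset.mem_erase.2 ⟨hji, hj⟩) (by simp), mul_zero]

theorem Matrix.exists_left_inverse {m n : Type*} [Fintype m] [Fintype n] [DecidableEq m]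
    [DecidableEq n] (U : Matrix m n ℝ) (hU : ∀ x, U.mulVec x = 0 → x = 0) :
    ∃ B : Matrix n m ℝ, B * U = 1 := by
  obtain ⟨g, hg⟩ := (Matrix.toLin' U).exists_leftInverse_of_injective
    (LinearMap.ker_eq_bot'.2 fun x hx => hU x (by simpa using hx))
  refine ⟨LinearMap.toMatrix' g, ?_⟩
  have h := LinearMap.toMatrix'_comp g (Matrix.toLin' U)
  rwa [hg, LinearMap.toMatrix'_id, LinearMap.toMatrix'_toLin', eq_comm] at h

/-- The stacked matrix of a pair of linear combinations of independent sources, in terms of the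
coefficients `c` and the cumulants `κ` of the sources. -/
def sourceMatrix {R S : Type*} [CommRing R] [Fintype S] (k₁ k₂ : ℕ) (c : Fin 2 → S → R)
    (κ : ℕ → S → R) : Matrix (StackedRow k₁ k₂) (StackedCol k₁) R :=
  Matrix.of fun row col =>
    ∑ s, κ (k₁ + row.1) s * ((∏ j, c (col.1.1 j) s) * ∏ j, c (row.2.1 j) s)

theorem sourceMatrix_map {R R' S : Type*} [CommRing R] [CommRing R'] [Fintype S] (φ : R →+* R')
    (k₁ k₂ : ℕ) (c : Fin 2 → S → R) (κ : ℕ → S → R) :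
    (sourceMatrix k₁ k₂ c κ).map φ =
      sourceMatrix k₁ k₂ (fun i s => φ (c i s)) (fun k s => φ (κ k s)) := by
  ext row col
  simp [sourceMatrix, map_sum, map_prod]

theorem sourceMatrix_congr {R S : Type*} [CommRing R] [Fintype S] {k₁ k₂ : ℕ} (hk : k₁ ≤ k₂)
    {c : Fin 2 → S → R} {κ κ' : ℕ → S → R}
    (h : ∀ k, k₁ ≤ k → k ≤ k₂ → ∀ s, κ k s = κ' k s) :
    sourceMatrix k₁ k₂ c κ = sourceMatrix k₁ k₂ c κ' := by
  ext row col
  refine Finset.sum_congr rfl fun s _ => ?_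
  have := row.1.2
  rw [h _ (by omega) (by omega)]

theorem sourceMatrix_rank_le {S : Type*} [Fintype S] (k₁ k₂ : ℕ) (c : Fin 2 → S → ℝ)
    (κ : ℕ → S → ℝ) (T : Finset S) (hT : ∀ s ∉ T, c 0 s = 0) :
    (sourceMatrix k₁ k₂ c κ).rank ≤ T.card := by
  classical
  have : sourceMatrix k₁ k₂ c κ =
      (Matrix.of fun row (s : T) => κ (k₁ + row.1) s * ∏ j, c (row.2.1 j) s :
        Matrix (StackedRow k₁ k₂) T ℝ) *
      (Matrix.of fun (s : T) col => ∏ j, c (col.1.1 j) s : Matrix T (StackedCol k₁) ℝ) := by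
    ext row col
    simp only [sourceMatrix, Matrix.mul_apply, Matrix.of_apply]
    rw [Finset.sum_coe_sort T fun s =>
      κ (k₁ + row.1) s * (∏ j, c (row.2.1 j) s) * ∏ j, c (col.1.1 j) s]
    symm
    refine Finset.sum_subset_zero_on_sdiff (Finset.subset_univ T) (fun s hs => ?_)
      fun s _ => by ring
    -- A column other than the removed one contains index `0`, which kills any source with `c 0 s =
    -- 0`.
    obtain ⟨j, hj⟩ := Function.ne_iff.1 col.2
    have hj0 : col.1.1 j = 0 := by
      generalize col.1.1 j = x at hj
      fin_cases x <;> simp_all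
    have : ∏ j, c (col.1.1 j) s = 0 :=
      Finset.prod_eq_zero (mem_univ j) (by rw [hj0]; exact hT s (Finset.mem_sdiff.1 hs).2)
    rw [this]
    ring
  rw [this]
  refine (Matrix.rank_mul_le_left _ _).trans ((Matrix.rank_le_card_width _).trans ?_)
  simp

theorem Matrix.rank_le_stackedMinDim {k₁ k₂ : ℕ}
    (A : Matrix (StackedRow k₁ k₂) (StackedCol k₁) ℝ) : A.rank ≤ stackedMinDim k₁ k₂ := by
  rw [stackedMinDim, Nat.card_eq_fintype_card, Nat.card_eq_fintype_card]
  exact le_min A.rank_le_card_height A.rank_le_card_width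

/-- Rows of order one must be avoided, as centered sources have zero first cumulant. They occur only
for `k₁ = 1`; then there is at most one column, and one row of order two, available by `k₁ < k₂`, is
enough. -/
theorem exists_embedding_stackedRow {p k₁ k₂ : ℕ} (hk₁ : 1 ≤ k₁) (hk : k₁ < k₂)
    (hp : p ≤ stackedMinDim k₁ k₂) :
    ∃ e : Fin p → StackedRow k₁ k₂, Function.Injective e ∧ ∀ i, 2 ≤ k₁ + ((e i).1 : ℕ) := by
  rw [stackedMinDim, Nat.card_eq_fintype_card, Nat.card_eq_fintype_card] at hp
  obtain hk₁' | hk₁' := hk₁.lt_or_eq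
  · obtain ⟨e⟩ := Function.Embedding.nonempty_of_card_le (α := Fin p) (β := StackedRow k₁ k₂)
      (by simpa using hp.trans (min_le_left _ _))
    exact ⟨e, e.injective, fun i => by omega⟩
  · subst hk₁'
    have hp1 : p ≤ 1 := (hp.trans (min_le_right _ _)).trans (StackedCol.card_le 1)
    have : Subsingleton (Fin p) := Fin.subsingleton_iff_le_one.2 hp1
    obtain ⟨i, _⟩ := SortedIndex.exists_weight_eq (Nat.zero_le 1)
    exact ⟨fun _ => ⟨⟨1, by omega⟩, i⟩, Function.injective_of_subsingleton _, fun _ => le_rfl⟩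

/-- For suitable cumulants of the sources, the stacked matrix has the largest rank allowed by its
size and by the number of sources that contribute. -/
theorem exists_mul_sourceMatrix_mul_eq_one {S : Type*} [Fintype S] {p k₁ k₂ : ℕ} (hk₁ : 1 ≤ k₁)
    (hk : k₁ < k₂) (hp : p ≤ stackedMinDim k₁ k₂) (c : Fin 2 → S → ℝ) (τ : Fin p → S)
    (h0 : ∀ i, c 0 (τ i) ≠ 0) (ht : Function.Injective fun i => c 1 (τ i) / c 0 (τ i)) :
    ∃ κ : ℕ → S → ℝ, (∀ k < 2, ∀ s, κ k s = 0) ∧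
      ∃ (B : Matrix (Fin p) (StackedRow k₁ k₂) ℝ) (D : Matrix (StackedCol k₁) (Fin p) ℝ),
        B * sourceMatrix k₁ k₂ c κ * D = 1 := by
  classical
  obtain ⟨e, he, he2⟩ := exists_embedding_stackedRow hk₁ hk hp
  set t : Fin p → ℝ := fun i => c 1 (τ i) / c 0 (τ i) with ht_def
  have hc : ∀ i, c 1 (τ i) = c 0 (τ i) * t i := fun i => (mul_div_cancel₀ _ (h0 i)).symm
  -- Source `τ i` is active only at the order of row `e i`; the inverse power cancels the factor `c
  -- 0 s ^ k` from all `k` indices.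
  let κ : ℕ → S → ℝ := fun k s =>
    ∑ i, if τ i = s ∧ k = k₁ + (e i).1 then (c 0 s ^ k)⁻¹ else 0
  let U : Matrix (StackedRow k₁ k₂) (Fin p) ℝ := Matrix.of fun row i =>
    if row.1 = (e i).1 then t i ^ row.2.weight else 0
  let V : Matrix (StackedCol k₁) (Fin p) ℝ := Matrix.of fun col i => t i ^ col.1.weight
  have hUV : sourceMatrix k₁ k₂ c κ = U * V.transpose := by
    ext row col
    simp only [sourceMatrix, Matrix.mul_apply, Matrix.of_apply, κ, U, V, Matrix.transpose_apply,
      Finset.sum_mul]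
    rw [Finset.sum_comm]
    refine Finset.sum_congr rfl fun i _ => ?_
    by_cases hrow : row.1 = (e i).1
    · rw [if_pos hrow, Finset.sum_eq_single_of_mem (τ i) (mem_univ _)]
      · rw [if_pos ⟨rfl, by rw [hrow]⟩, col.1.prod_apply (c := fun x => c x (τ i)) (hc i),
          row.2.prod_apply (c := fun x => c x (τ i)) (hc i), pow_add]
        have := h0 i
        field_simp
      · intro s _ hs
        rw [if_neg fun h => hs h.1.symm, zero_mul]
    · rw [if_neg hrow, zero_mul]
      refine Finset.sum_eq_zero fun s _ => ?_
      rw [if_neg, zero_mul]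
      rintro ⟨_, h⟩
      exact hrow (Fin.ext (by omega))
  -- `U` is block diagonal by order. At order `k₁ + d` at most `d + 1` sources are active, because
  -- `e` is injective and weights lie in `0, …, d`, while all `d + 1` powers are available as rows.
  obtain ⟨B, hB⟩ := U.exists_left_inverse (by
    intro x hx
    funext i
    refine eq_zero_of_sum_mul_pow_eq_zero ht (G := univ.filter fun j => (e j).1 = (e i).1)
      (n := ((e i).1 : ℕ) + 1) ?_ ?_ i (by simp)
    · rw [← Finset.card_range (((e i).1 : ℕ) + 1)]
      refine Finset.card_le_card_of_injOn (fun j => (e j).2.weight) ?_ ?_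
      · intro j hj
        have h1 : (e j).1 = (e i).1 := by simpa using hj
        have h2 := (e j).2.weight_le.trans_eq (congrArg Fin.val h1)
        simpa using Nat.lt_succ_of_le h2
      · intro j hj l hl hjl
        have h1 : (e j).1 = (e i).1 := by simpa using hj
        have h2 : (e l).1 = (e i).1 := by simpa using hl
        exact he (StackedRow.ext_weight (h1.trans h2.symm) hjl)
    · intro r hr
      obtain ⟨row, hrow⟩ := SortedIndex.exists_weight_eq (Nat.le_of_lt_succ hr)
      have := congrFun hx ⟨(e i).1, row⟩
      simp only [Matrix.mulVec, dotProduct, U, Matrix.of_apply, Pi.zero_apply, hrow] at this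
      rw [← this, Finset.sum_filter]
      refine Finset.sum_congr rfl fun j _ => ?_
      by_cases h : (e j).1 = (e i).1
      · rw [if_pos h, if_pos h.symm, mul_comm]
      · rw [if_neg h, if_neg (Ne.symm h), zero_mul])
  -- The remaining columns supply the powers `0, …, k₁ - 1`, and `p ≤ k₁`.
  obtain ⟨D, hD⟩ := V.exists_left_inverse (by
    intro x hx
    funext i
    refine eq_zero_of_sum_mul_pow_eq_zero ht (G := univ) (n := k₁) ?_ ?_ i (mem_univ i)
    · rw [Finset.card_univ, Fintype.card_fin]
      rw [stackedMinDim, Nat.card_eq_fintype_card, Nat.card_eq_fintype_card] at hp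
      exact (hp.trans (min_le_right _ _)).trans (StackedCol.card_le k₁)
    · intro r hr
      obtain ⟨col, hcol⟩ := SortedIndex.exists_weight_eq hr.le
      have := congrFun hx ⟨col, col.weight_lt_iff.1 (hcol.trans_lt hr)⟩
      simp only [Matrix.mulVec, dotProduct, V, Matrix.of_apply, Pi.zero_apply, hcol] at this
      rw [← this]
      exact Finset.sum_congr rfl fun j _ => mul_comm _ _)
  refine ⟨κ, ?_, B, D.transpose, ?_⟩
  · intro k hk2 s
    refine Finset.sum_eq_zero fun i _ => if_neg ?_
    rintro ⟨_, h⟩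
    have := he2 i
    omega
  · rw [hUV, ← Matrix.mul_assoc, hB, Matrix.one_mul, ← Matrix.transpose_mul, hD,
      Matrix.transpose_one]

theorem Matrix.le_rank_of_det_mul_mul_ne_zero {m n : Type*} [Fintype m] [Fintype n] {p : ℕ}
    (A : Matrix m n ℝ) (B : Matrix (Fin p) m ℝ) (D : Matrix n (Fin p) ℝ)
    (h : (B * A * D).det ≠ 0) : p ≤ A.rank := by
  have h1 := Matrix.rank_of_isUnit (B * A * D)
    ((Matrix.isUnit_iff_isUnit_det _).2 (isUnit_iff_ne_zero.2 h))
  rw [Fintype.card_fin] at h1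
  calc p = (B * A * D).rank := h1.symm
    _ ≤ (B * A).rank := Matrix.rank_mul_le_left _ _
    _ ≤ A.rank := Matrix.rank_mul_le_right _ _

/-- The exceptional polynomial is a compressed determinant with constant `B` and `D`, equal to `1`
at the point given by `hpoint`. That point need not be the parameter of any model, nor satisfy
`hyp`. -/
theorem holdsGenerically_rank_sourceMatrix {σ S : Type*} {M : Type*} [Fintype S]
    {k₁ k₂ : ℕ} (hk₁ : 1 ≤ k₁) (hk : k₁ < k₂) (param : M → σ → ℝ) (hyp : M → Prop)
    (A : M → Matrix (StackedRow k₁ k₂) (StackedCol k₁) ℝ)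
    (cP : Fin 2 → S → MvPolynomial σ ℝ) (κP : ℕ → S → MvPolynomial σ ℝ)
    (hA : ∀ m, hyp m → A m = sourceMatrix k₁ k₂ (fun i s => MvPolynomial.eval (param m) (cP i s))
      (fun k s => MvPolynomial.eval (param m) (κP k s)))
    (T : Finset S) (hT : ∀ m, hyp m → ∀ s ∉ T, MvPolynomial.eval (param m) (cP 0 s) = 0)
    (c : Fin 2 → S → ℝ) (h0 : ∀ s ∈ T, c 0 s ≠ 0)
    (ht : Set.InjOn (fun s => c 1 s / c 0 s) (T : Set S))
    (hpoint : ∀ κ : ℕ → S → ℝ, (∀ k < 2, ∀ s, κ k s = 0) → ∃ x : σ → ℝ,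
      (∀ i s, MvPolynomial.eval x (cP i s) = c i s) ∧
      ∀ k, k₁ ≤ k → k ≤ k₂ → ∀ s, MvPolynomial.eval x (κP k s) = κ k s) :
    HoldsGenerically param fun m => hyp m → (A m).rank = min T.card (stackedMinDim k₁ k₂) := by
  classical
  set p := min T.card (stackedMinDim k₁ k₂) with hp
  obtain ⟨τ⟩ := Function.Embedding.nonempty_of_card_le (α := Fin p) (β := T)
    (by simp [hp])
  obtain ⟨κ, hκ, B, D, hBD⟩ := exists_mul_sourceMatrix_mul_eq_one (p := p) hk₁ hk
    (min_le_right _ _) c (fun i => (τ i : S)) (fun i => h0 _ (τ i).2)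
    (fun i j hij => τ.injective (Subtype.ext (ht (τ i).2 (τ j).2 hij)))
  let f : MvPolynomial σ ℝ :=
    ((B.map MvPolynomial.C : Matrix _ _ (MvPolynomial σ ℝ)) * sourceMatrix k₁ k₂ cP κP *
      (D.map MvPolynomial.C : Matrix _ _ (MvPolynomial σ ℝ))).det
  have hf : ∀ x, MvPolynomial.eval x f = (B * sourceMatrix k₁ k₂
      (fun i s => MvPolynomial.eval x (cP i s))
      (fun k s => MvPolynomial.eval x (κP k s)) * D).det := by
    intro x
    simp only [f]
    rw [RingHom.map_det, RingHom.mapMatrix_apply, Matrix.map_mul, Matrix.map_mul,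
      sourceMatrix_map, Matrix.map_map, Matrix.map_map]
    congr 3
    · ext; simp
    · ext; simp
  refine ⟨f, ?_, ?_⟩
  · intro hf0
    obtain ⟨x, hx, hx'⟩ := hpoint κ hκ
    have h1 := hf x
    rw [hf0, map_zero, sourceMatrix_congr hk.le hx'] at h1
    simp only [hx] at h1
    rw [hBD, Matrix.det_one] at h1
    exact zero_ne_one h1
  · intro m hm hyp_m
    refine le_antisymm (le_min ?_ (Matrix.rank_le_stackedMinDim _)) ?_
    · rw [hA m hyp_m]
      exact sourceMatrix_rank_le _ _ _ _ T (hT m hyp_m)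
    · rw [hf, ← hA m hyp_m] at hm
      exact Matrix.le_rank_of_det_mul_mul_ne_zero _ B D hm

end Rank

/-! ### Application to the two-variable model -/

section Model

open Finset

/-- The coefficients of the two observed variables in terms of the sources `ε₁, ε₂, L₁, …, L_ℓ`. -/
def observedCoeff {R : Type*} [CommRing R] {ℓ : ℕ} (lam : R) (gamma : Fin ℓ → R) :
    Fin 2 → Fin 2 ⊕ Fin ℓ → R :=
  ![Sum.elim ![1, 0] fun _ => 1, Sum.elim ![lam, 1] fun j => lam + gamma j]

theorem map_observedCoeff {R R' : Type*} [CommRing R] [CommRing R'] {ℓ : ℕ} (φ : R →+* R')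
    (lam : R) (gamma : Fin ℓ → R) (i : Fin 2) (s : Fin 2 ⊕ Fin ℓ) :
    φ (observedCoeff lam gamma i s) = observedCoeff (φ lam) (fun j => φ (gamma j)) i s := by
  fin_cases i <;> obtain s | s := s
  · fin_cases s <;> simp [observedCoeff]
  · simp [observedCoeff]
  · fin_cases s <;> simp [observedCoeff]
  · simp [observedCoeff]

namespace TwoVariableModel

variable {ℓ K : ℕ}

theorem X_ae_eq (S : TwoVariableModel.{u} ℓ K) (a : Fin 2) :
    S.X a =ᵐ[S.P] fun ω => ∑ s, observedCoeff S.lam S.gamma a s * S.eta s ω := by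
  fin_cases a
  · filter_upwards [S.eq_one] with ω h
    simp [h, observedCoeff, eta, Fintype.sum_sum_type, add_comm]
  · filter_upwards [S.eq_one, S.eq_two] with ω h h'
    simp only [Fin.mk_one, h', h, observedCoeff, eta, Fintype.sum_sum_type, Fin.sum_univ_two,
      Sum.elim_inl, Sum.elim_inr, Matrix.cons_val_zero, Matrix.cons_val_one, add_mul,
      Finset.sum_add_distrib, ← Finset.mul_sum]
    ring

theorem stackedCumulantMatrix_eq {k₁ : ℕ} (S : TwoVariableModel.{u} ℓ K) (hk₁ : 1 ≤ k₁)
    (hk : k₁ ≤ K) (v : Fin 2 → Fin 2) :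
    stackedCumulantMatrix S.P (S.X (v 0)) (S.X (v 1)) k₁ K =
      sourceMatrix k₁ K (fun i => observedCoeff S.lam S.gamma (v i))
        (fun k s => cumulantTensor S.P S.eta k fun _ => s) := by
  ext row col
  have hrow := row.1.2
  have hvec : ∀ a, (![S.X (v 0), S.X (v 1)] : Fin 2 → S.Ω → ℝ) a =ᵐ[S.P]
      fun ω => ∑ s, observedCoeff S.lam S.gamma (v a) s * S.eta s ω := by
    intro a
    fin_cases a
    · exact S.X_ae_eq (v 0)
    · exact S.X_ae_eq (v 1)
  simp only [stackedCumulantMatrix, symFlattening, sourceMatrix, Matrix.of_apply]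
  rw [cumulantTensor_congr_ae hvec, cumulantTensor_independent_sum (K := K) (η := S.eta) (by omega)
    (by omega)
    S.memLp S.indep fun i => observedCoeff S.lam S.gamma (v i)]
  refine Finset.sum_congr rfl fun s _ => ?_
  rw [Fin.prod_univ_add]
  simp [Fin.append_left, Fin.append_right]

end TwoVariableModel

/-- The cumulants of the sources as polynomials in the parameters, the free parameters being indexed
through `ι`; the cumulants of order one are zero. -/
noncomputable def cumulantPoly {ℓ K : ℕ} {σ : Type*} (ι : FreeParam ℓ K → σ) (k : ℕ)
    (s : Fin 2 ⊕ Fin ℓ) : MvPolynomial σ ℝ :=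
  if h : k ∈ Finset.Icc 2 K then MvPolynomial.X (ι (.cumulant s ⟨k, h⟩)) else 0

theorem TwoVariableModel.eval_cumulantPoly {ℓ K k : ℕ} {σ : Type*} {ι : FreeParam ℓ K → σ}
    (S : TwoVariableModel.{u} ℓ K) {x : σ → ℝ} (hx : ∀ q, x (ι q) = S.freeParams q)
    (hk : 1 ≤ k) (hkK : k ≤ K) (s : Fin 2 ⊕ Fin ℓ) :
    MvPolynomial.eval x (cumulantPoly ι k s) = cumulantTensor S.P S.eta k fun _ => s := by
  obtain rfl | hk := hk.eq_or_lt
  · rw [cumulantTensor_one_eq_zero _ (S.centered s)]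
    simp [cumulantPoly]
  · rw [cumulantPoly, dif_pos (Finset.mem_Icc.2 ⟨hk, hkK⟩), MvPolynomial.eval_X, hx]
    rfl

theorem eval_cumulantPoly_of_eq {ℓ K k : ℕ} {σ : Type*} {ι : FreeParam ℓ K → σ} {x : σ → ℝ}
    {κ : ℕ → Fin 2 ⊕ Fin ℓ → ℝ} (hx : ∀ s k, x (ι (.cumulant s k)) = κ k s)
    (hκ : ∀ k < 2, ∀ s, κ k s = 0) (hkK : k ≤ K) (s : Fin 2 ⊕ Fin ℓ) :
    MvPolynomial.eval x (cumulantPoly ι k s) = κ k s := by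
  by_cases hk : 2 ≤ k
  · rw [cumulantPoly, dif_pos (Finset.mem_Icc.2 ⟨hk, hkK⟩), MvPolynomial.eval_X, hx]
  · rw [cumulantPoly, dif_neg (by simp [hk]), map_zero, hκ _ (not_le.1 hk)]

namespace TwoVariableModel

/-- Generic rank of the stacked matrix: `v` orders the two observed variables, `T` is the set of
sources that enter the first of them, and `lam₀, gamma₀` is a point where the sources in `T` have
pairwise distinct coefficient ratios. -/
theorem holdsGenerically_rank {ℓ k₁ k₂ : ℕ} {σ : Type*} (hk₁ : 1 ≤ k₁) (hk : k₁ < k₂)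
    (v : Fin 2 → Fin 2) (param : TwoVariableModel.{u} ℓ k₂ → σ → ℝ)
    (hyp : TwoVariableModel.{u} ℓ k₂ → Prop) (ι : FreeParam ℓ k₂ → σ)
    (hι : ∀ S q, param S (ι q) = S.freeParams q) (lamP : MvPolynomial σ ℝ)
    (hlam : ∀ S, hyp S → MvPolynomial.eval (param S) lamP = S.lam)
    (T : Finset (Fin 2 ⊕ Fin ℓ))
    (hT : ∀ S : TwoVariableModel.{u} ℓ k₂, hyp S → ∀ s ∉ T,
      observedCoeff S.lam S.gamma (v 0) s = 0)
    (lam₀ : ℝ) (gamma₀ : Fin ℓ → ℝ)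
    (h0 : ∀ s ∈ T, observedCoeff lam₀ gamma₀ (v 0) s ≠ 0)
    (ht : Set.InjOn (fun s => observedCoeff lam₀ gamma₀ (v 1) s /
      observedCoeff lam₀ gamma₀ (v 0) s) (T : Set (Fin 2 ⊕ Fin ℓ)))
    (hpoint : ∀ y : FreeParam ℓ k₂ → ℝ, ∃ x : σ → ℝ, (∀ q, x (ι q) = y q) ∧
      MvPolynomial.eval x lamP = lam₀) :
    HoldsGenerically param fun S => hyp S →
      (stackedCumulantMatrix S.P (S.X (v 0)) (S.X (v 1)) k₁ k₂).rank =
        min T.card (stackedMinDim k₁ k₂) := by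
  have hcoeff : ∀ (S : TwoVariableModel.{u} ℓ k₂), hyp S → ∀ i s,
      MvPolynomial.eval (param S)
        (observedCoeff lamP (fun j => MvPolynomial.X (ι (.gamma j))) i s) =
      observedCoeff S.lam S.gamma i s := by
    intro S hS i s
    rw [map_observedCoeff, hlam S hS]
    simp only [MvPolynomial.eval_X, hι]
    rfl
  refine holdsGenerically_rank_sourceMatrix hk₁ hk param hyp _
    (fun i => observedCoeff lamP (fun j => MvPolynomial.X (ι (.gamma j))) (v i))
    (cumulantPoly ι) ?_ T ?_ (fun i => observedCoeff lam₀ gamma₀ (v i)) h0 ht ?_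
  · intro S hS
    rw [S.stackedCumulantMatrix_eq hk₁ hk.le v]
    simp only [hcoeff S hS]
    exact sourceMatrix_congr hk.le fun k hk hk' s =>
      (S.eval_cumulantPoly (hι S) (hk₁.trans hk) hk' s).symm
  · intro S hS s hs
    rw [hcoeff S hS]
    exact hT S hS s hs
  · intro κ hκ
    let y : FreeParam ℓ k₂ → ℝ
      | .gamma j => gamma₀ j
      | .cumulant s k => κ k s
    obtain ⟨x, hx, hxl⟩ := hpoint y
    refine ⟨x, fun i s => ?_, fun k _ hk' s => eval_cumulantPoly_of_eq (fun s k => hx _) hκ hk' s⟩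
    rw [map_observedCoeff, hxl]
    simp only [MvPolynomial.eval_X, hx]
    rfl

theorem rank_stackedCumulantMatrix_le {ℓ k₁ k₂ : ℕ} (S : TwoVariableModel.{u} ℓ k₂)
    (hk₁ : 1 ≤ k₁) (hk : k₁ ≤ k₂) (v : Fin 2 → Fin 2) (T : Finset (Fin 2 ⊕ Fin ℓ))
    (hT : ∀ s ∉ T, observedCoeff S.lam S.gamma (v 0) s = 0) :
    (stackedCumulantMatrix S.P (S.X (v 0)) (S.X (v 1)) k₁ k₂).rank ≤ T.card := by
  rw [S.stackedCumulantMatrix_eq hk₁ hk v]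
  exact sourceMatrix_rank_le _ _ _ _ T hT

end TwoVariableModel

theorem card_erase_inl (ℓ : ℕ) (i : Fin 2) :
    ((univ : Finset (Fin 2 ⊕ Fin ℓ)).erase (.inl i)).card = ℓ + 1 := by
  rw [Finset.card_erase_of_mem (mem_univ _), Finset.card_univ, Fintype.card_sum, Fintype.card_fin,
    Fintype.card_fin]
  omega

/-- The ratios are `lam₀` for `ε₁` and `lam₀ + j + 1` for `L_j`; `ε₂` does not enter `X₁`. -/
theorem observedCoeff_ratio_injOn_erase {ℓ : ℕ} (lam₀ : ℝ) :
    Set.InjOn (fun s => observedCoeff lam₀ (fun j : Fin ℓ => (j : ℝ) + 1) 1 s /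
      observedCoeff lam₀ (fun j : Fin ℓ => (j : ℝ) + 1) 0 s)
      ((univ : Finset (Fin 2 ⊕ Fin ℓ)).erase (.inl 1) : Finset _) := by
  have hpos : ∀ j : Fin ℓ, ((j : ℕ) : ℝ) + 1 ≠ 0 := fun j => by positivity
  rintro (s | s) hs (s' | s') hs' h
  · fin_cases s <;> fin_cases s' <;> simp_all
  · fin_cases s <;> simp_all [observedCoeff]
  · fin_cases s' <;> simp_all [observedCoeff]
  · simpa [observedCoeff, Fin.val_inj] using h

/-- The ratios are `1` for `ε₁`, `0` for `ε₂` and `1 / (j + 2)` for `L_j`. -/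
theorem observedCoeff_swap_ratio_injective {ℓ : ℕ} :
    Function.Injective (fun s => observedCoeff (1 : ℝ) (fun j : Fin ℓ => (j : ℝ) + 1) 0 s /
      observedCoeff (1 : ℝ) (fun j : Fin ℓ => (j : ℝ) + 1) 1 s) := by
  have hpos : ∀ j : Fin ℓ, ((j : ℕ) : ℝ) + 1 ≠ 0 := fun j => by positivity
  have hpos' : ∀ j : Fin ℓ, 1 + (((j : ℕ) : ℝ) + 1) ≠ 0 := fun j => by positivity
  rintro (s | s) (s' | s') h
  · fin_cases s <;> fin_cases s' <;> simp_all [observedCoeff]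
  · fin_cases s <;> simp_all [observedCoeff, eq_comm]
  · fin_cases s' <;> simp_all [observedCoeff]
  · simpa [observedCoeff, Fin.val_inj] using h

/-- The ratios are `0` for `ε₂` and `1 / (j + 1)` for `L_j`; `ε₁` does not enter `X₂` when `λ₂₁ =
0`. -/
theorem observedCoeff_swap_ratio_injOn_erase {ℓ : ℕ} :
    Set.InjOn (fun s => observedCoeff (0 : ℝ) (fun j : Fin ℓ => (j : ℝ) + 1) 0 s /
      observedCoeff (0 : ℝ) (fun j : Fin ℓ => (j : ℝ) + 1) 1 s)
      ((univ : Finset (Fin 2 ⊕ Fin ℓ)).erase (.inl 0) : Finset _) := by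
  have hpos : ∀ j : Fin ℓ, ((j : ℕ) : ℝ) + 1 ≠ 0 := fun j => by positivity
  rintro (s | s) hs (s' | s') hs' h
  · fin_cases s <;> fin_cases s' <;> simp_all
  · fin_cases s <;> simp_all [observedCoeff, eq_comm]
  · fin_cases s' <;> simp_all [observedCoeff]
  · simpa [observedCoeff, Fin.val_inj] using h

theorem observedCoeff_zero_ne_zero {ℓ : ℕ} (lam₀ : ℝ) (gamma₀ : Fin ℓ → ℝ) :
    ∀ s ∈ (univ : Finset (Fin 2 ⊕ Fin ℓ)).erase (.inl 1), observedCoeff lam₀ gamma₀ 0 s ≠ 0 := by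
  rintro (s | s) hs
  · fin_cases s <;> simp_all [observedCoeff]
  · simp [observedCoeff]

theorem observedCoeff_zero_eq_zero {ℓ : ℕ} (lam₀ : ℝ) (gamma₀ : Fin ℓ → ℝ) :
    ∀ s ∉ (univ : Finset (Fin 2 ⊕ Fin ℓ)).erase (.inl 1), observedCoeff lam₀ gamma₀ 0 s = 0 := by
  intro s hs
  obtain rfl : s = .inl 1 := by simpa using hs
  simp [observedCoeff]

theorem observedCoeff_one_eq_zero {ℓ : ℕ} {lam₀ : ℝ} (hlam : lam₀ = 0) (gamma₀ : Fin ℓ → ℝ) :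
    ∀ s ∉ (univ : Finset (Fin 2 ⊕ Fin ℓ)).erase (.inl 0), observedCoeff lam₀ gamma₀ 1 s = 0 := by
  intro s hs
  obtain rfl : s = .inl 0 := by simpa using hs
  simp [observedCoeff, hlam]

theorem observedCoeff_one_ne_zero {ℓ : ℕ} :
    ∀ s ∈ (univ : Finset (Fin 2 ⊕ Fin ℓ)).erase (.inl 0),
      observedCoeff (0 : ℝ) (fun j : Fin ℓ => (j : ℝ) + 1) 1 s ≠ 0 := by
  have hpos : ∀ j : Fin ℓ, ((j : ℕ) : ℝ) + 1 ≠ 0 := fun j => by positivity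
  rintro (s | s) hs
  · fin_cases s <;> simp_all [observedCoeff]
  · simp [observedCoeff, hpos]

theorem observedCoeff_one_ne_zero_of_lam {ℓ : ℕ} (s : Fin 2 ⊕ Fin ℓ) :
    observedCoeff (1 : ℝ) (fun j : Fin ℓ => (j : ℝ) + 1) 1 s ≠ 0 := by
  have hpos : ∀ j : Fin ℓ, 1 + (((j : ℕ) : ℝ) + 1) ≠ 0 := fun j => by positivity
  obtain s | s := s
  · fin_cases s <;> simp [observedCoeff]
  · simp [observedCoeff, hpos]

theorem exists_allParams_point {ℓ K : ℕ} (lam₀ : ℝ) (y : FreeParam ℓ K → ℝ) :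
    ∃ x : Option (FreeParam ℓ K) → ℝ, (∀ q, x (some q) = y q) ∧
      MvPolynomial.eval x (MvPolynomial.X none) = lam₀ :=
  ⟨fun o => o.elim lam₀ y, fun _ => rfl, by simp⟩

theorem exists_freeParams_point {ℓ K : ℕ} (y : FreeParam ℓ K → ℝ) :
    ∃ x : FreeParam ℓ K → ℝ, (∀ q, x (id q) = y q) ∧ MvPolynomial.eval x 0 = (0 : ℝ) :=
  ⟨y, fun _ => rfl, map_zero _⟩

end Model

theorem mainTheorem2 (ℓ k₁ k₂ : ℕ) (hk₁ : 1 ≤ k₁) (hk : k₁ < k₂) :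
    -- a)
    ((∀ S : TwoVariableModel.{u} ℓ k₂, (S.A₁₂ k₁ k₂).rank ≤ ℓ + 1) ∧
      HoldsGenerically TwoVariableModel.allParams (fun S : TwoVariableModel.{u} ℓ k₂ =>
        S.lam ≠ 0 → (S.A₁₂ k₁ k₂).rank = min (ℓ + 1) (stackedMinDim k₁ k₂)) ∧
      HoldsGenerically TwoVariableModel.freeParams (fun S : TwoVariableModel.{u} ℓ k₂ =>
        S.lam = 0 → (S.A₁₂ k₁ k₂).rank = min (ℓ + 1) (stackedMinDim k₁ k₂))) ∧
    -- b)
    ((∀ S : TwoVariableModel.{u} ℓ k₂, S.lam ≠ 0 → (S.A₂₁ k₁ k₂).rank ≤ ℓ + 2) ∧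
      HoldsGenerically TwoVariableModel.allParams (fun S : TwoVariableModel.{u} ℓ k₂ =>
        S.lam ≠ 0 → (S.A₂₁ k₁ k₂).rank = min (ℓ + 2) (stackedMinDim k₁ k₂))) ∧
    -- c)
    ((∀ S : TwoVariableModel.{u} ℓ k₂, S.lam = 0 → (S.A₂₁ k₁ k₂).rank ≤ ℓ + 1) ∧
      HoldsGenerically TwoVariableModel.freeParams (fun S : TwoVariableModel.{u} ℓ k₂ =>
        S.lam = 0 → (S.A₂₁ k₁ k₂).rank = min (ℓ + 1) (stackedMinDim k₁ k₂))) := by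
  have hcard : (Finset.univ : Finset (Fin 2 ⊕ Fin ℓ)).card = ℓ + 2 := by
    simp [add_comm]
  refine ⟨⟨fun S => ?_, ?_, ?_⟩, ⟨fun S _ => ?_, ?_⟩, fun S hS => ?_, ?_⟩
  · rw [← card_erase_inl ℓ 1]
    exact S.rank_stackedCumulantMatrix_le hk₁ hk.le ![0, 1] _ (observedCoeff_zero_eq_zero _ _)
  · rw [← card_erase_inl ℓ 1]
    -- The witness may have `λ₂₁ = 0` although the claim concerns `λ₂₁ ≠ 0`: it only shows that the
    -- polynomial is nonzero.
    exact TwoVariableModel.holdsGenerically_rank hk₁ hk ![0, 1] _ _ some (fun _ _ => rfl)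
      (MvPolynomial.X none) (fun _ _ => MvPolynomial.eval_X _) _
      (fun _ _ => observedCoeff_zero_eq_zero _ _) 0 _ (observedCoeff_zero_ne_zero _ _)
      (observedCoeff_ratio_injOn_erase 0) (exists_allParams_point 0)
  · rw [← card_erase_inl ℓ 1]
    -- Here `λ₂₁` is not a parameter and is represented by the zero polynomial.
    exact TwoVariableModel.holdsGenerically_rank hk₁ hk ![0, 1] _ _ id (fun _ _ => rfl)
      0 (fun _ h => (map_zero _).trans h.symm) _
      (fun _ _ => observedCoeff_zero_eq_zero _ _) 0 _ (observedCoeff_zero_ne_zero _ _)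
      (observedCoeff_ratio_injOn_erase 0) exists_freeParams_point
  · rw [← hcard]
    exact S.rank_stackedCumulantMatrix_le hk₁ hk.le ![1, 0] _
      fun s hs => absurd (Finset.mem_univ s) hs
  · rw [← hcard]
    exact TwoVariableModel.holdsGenerically_rank hk₁ hk ![1, 0] _ _ some (fun _ _ => rfl)
      (MvPolynomial.X none) (fun _ _ => MvPolynomial.eval_X _) _
      (fun _ _ s hs => absurd (Finset.mem_univ s) hs) 1 _ (fun s _ => observedCoeff_one_ne_zero_of_lam s)
      observedCoeff_swap_ratio_injective.injOn (exists_allParams_point 1)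
  · rw [← card_erase_inl ℓ 0]
    exact S.rank_stackedCumulantMatrix_le hk₁ hk.le ![1, 0] _ (observedCoeff_one_eq_zero hS _)
  · rw [← card_erase_inl ℓ 0]
    exact TwoVariableModel.holdsGenerically_rank hk₁ hk ![1, 0] _ _ id (fun _ _ => rfl)
      0 (fun _ h => (map_zero _).trans h.symm) _
      (fun _ h => observedCoeff_one_eq_zero h _) 0 _ observedCoeff_one_ne_zero
      observedCoeff_swap_ratio_injOn_erase exists_freeParams_point
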